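/- Let $f:\mathbb{R}^p\to\mathbb{R}\cup\{+\infty\}$ and $g:\mathbb{R}^n\to\mathbb{R}\cup\{+\infty\}$ be proper, closed and convex, let $K:\mathbb{R}^p\to\mathbb{R}^n$ be a nonzero linear operator, and let $h^*$ denote the Fenchel conjugate of $h$. Put $\mathcal{L}(x,y):=f(x)+\langle Kx,y\rangle-g^*(y)$, $F(x):=f(x)+g(Kx)$, $F^\star:=\min_x F(x)$, $D(y):=f^*(-K^\top y)+g^*(y)$, $D^\star:=\min_y D(y)$. Assume that $\mathcal{L}$ has a saddle point, i.e. a point $(x^\star,y^\star)\in\operatorname{dom} f\times\operatorname{dom} g^*$ with $\mathcal{L}(x^\star,y)\le\mathcal{L}(x^\star,y^\star)\le\mathcal{L}(x,y^\star)$ for all $(x,y)\in\operatorname{dom} f\times\operatorname{dom} g^*$, that $0\in\operatorname{ri}(\operatorname{dom} g-K\operatorname{dom} f)$, and that $f$ is $\mu_f$-strongly convex for some $\mu_f>0$ (i.e. $f-\frac{\mu_f}{2}\|\cdot\|^2$ is convex; no strong convexity of $g^*$ is assumed). Let $x^0\in\operatorname{dom} f$, $\tilde y^0\in\operatorname{dom}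 g^*$, $\dot y\in\mathbb{R}^n$, $\hat x^0:=x^0$, $\tau_0:=1$, $\beta_0\ge 0.382\,\|K\|^2/\mu_f$, and for $k\ge 0$ let $$\tau_{k+1}:=\tfrac{\tau_k}{2}\Big(\sqrt{\tau_k^2+4}-\tau_k\Big),\quad \beta_{k+1}:=\frac{\beta_k}{1+\tau_{k+1}},\quad L_k:=\frac{\|K\|^2}{\beta_k},\quad m_{k+1}:=\frac{L_{k+1}+\mu_f}{L_k+\mu_f},\quad \eta_{k+1}:=\frac{(1-\tau_k)\tau_k}{\tau_k^2+m_{k+1}\tau_{k+1}},$$ $$y^{k+1}:=\operatorname{prox}_{g^*/\beta_k}\big(\dot y+\tfrac1{\beta_k}K\hat x^k\big),\qquad x^{k+1}:=\operatorname{prox}_{f/L_k}\big(\hat x^k-\tfrac1{L_k}K^\top y^{k+1}\big),$$ $$\hat x^{k+1}:=x^{k+1}+\eta_{k+1}(x^{k+1}-x^k),\qquad \tilde y^{k+1}:=(1-\tau_k)\tilde y^k+\tau_k y^{k+1}.$$ Then, for every $k\ge 1$: (a) For all nonempty closed convex sets $\mathcal{X}\subseteq\operatorname{dom} f$ and $\mathcal{Y}\subseteq\operatorname{dom}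 g^*$ such that $\mathcal{X}\times\mathcal{Y}$ contains a saddle point of $\mathcal{L}$, the gap function $\mathcal{G}_{\mathcal{X}\times\mathcal{Y}}(x,y):=\sup\{\mathcal{L}(x,y')-\mathcal{L}(x',y):x'\in\mathcal{X},\,y'\in\mathcal{Y}\}$ satisfies $$\mathcal{G}_{\mathcal{X}\times\mathcal{Y}}(x^k,\tilde y^k)\le\frac{2\|K\|^2}{\beta_0(k+1)^2}\sup_{x\in\mathcal{X}}\|x^0-x\|^2+\frac{10\beta_0}{(k+3)^2}\sup_{y\in\mathcal{Y}}\|\dot y-y\|^2 .$$ (b) If $g$ is $M_g$-Lipschitz continuous on $\operatorname{dom} g$ and $Kx^k\in\operatorname{dom} g$ (which is automatic if $g$ is finite everywhere), then for every saddle point $(x^\star,y^\star)$ $$F(x^k)-F^\star\le\frac{2\|K\|^2\|x^0-x^\star\|^2}{\beta_0(k+1)^2}+\frac{10\beta_0(\|\dot y\|+M_g)^2}{(k+3)^2}.$$ (c) If $f^*$ is $M_{f^*}$-Lipschitz continuous on $\operatorname{dom} f^*$, then for every saddle point $(x^\star,y^\star)$ $$D(\tilde y^k)-D^\star\le\frac{2\|K\|^2(\|x^0\|+M_{f^*})^2}{\beta_0(k+1)^2}+\frac{10\beta_0\|\dot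 y-y^\star\|^2}{(k+3)^2}.$$ -/

import Mathlib

namespace ASGARD

section Functions

variable {E : Type*} [NormedAddCommGroup E] [InnerProductSpace ℝ E]

/-- The effective domain of an extended-real-valued function. -/
def effDom (f : E → EReal) : Set E := {x | f x < ⊤}

/-- Convexity of an extended-real-valued function: its epigraph is a convex set. -/
def IsConvexFn (f : E → EReal) : Prop :=
  Convex ℝ {q : E × ℝ | f q.1 ≤ (q.2 : EReal)}

/-- `f : E → ℝ ∪ {+∞}` is proper, closed (lower semicontinuous) and convex. -/
structure IsProperClosedConvex (f : E → EReal) : Prop where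
  ne_bot : ∀ x, f x ≠ ⊥
  nonempty_dom : (effDom f).Nonempty
  closed : LowerSemicontinuous f
  convex : IsConvexFn f

/-- `f` is `μ`-strongly convex: `f - (μ/2)‖·‖²` is convex. -/
def IsStronglyConvexFn (μ : ℝ) (f : E → EReal) : Prop :=
  IsConvexFn fun x => f x - ((μ / 2 * ‖x‖ ^ 2 : ℝ) : EReal)

/-- The Fenchel conjugate `f*(y) = sup_x {⟪y, x⟫ - f(x)}`. Points outside the domain of `f`
contribute `⊥` and do not change the supremum. -/
noncomputable def conj (f : E → EReal) (y : E) : EReal :=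
  ⨆ x, ((inner ℝ y x : ℝ) : EReal) - f x

/-- `f` is `M`-Lipschitz continuous on its domain, `M ∈ [0, ∞)`. -/
def IsLipschitzOnDom (M : ℝ) (f : E → EReal) : Prop :=
  0 ≤ M ∧ ∀ x ∈ effDom f, ∀ x' ∈ effDom f, |(f x).toReal - (f x').toReal| ≤ M * ‖x - x'‖

/-- `z = prox_{γ f}(x)`: `z` minimizes `w ↦ f(w) + ‖w - x‖² / (2γ)` over the domain of `f`. -/
def IsProx (γ : ℝ) (f : E → EReal) (x z : E) : Prop :=
  z ∈ effDom f ∧ ∀ w ∈ effDom f,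
    f z + ((1 / (2 * γ) * ‖z - x‖ ^ 2 : ℝ) : EReal)
      ≤ f w + ((1 / (2 * γ) * ‖w - x‖ ^ 2 : ℝ) : EReal)

end Functions

section Problem

variable {p n : ℕ}

/-- The Lagrangian `L(x, y) = f(x) + ⟪Kx, y⟫ - g*(y)`. -/
noncomputable def lagr (f : EuclideanSpace ℝ (Fin p) → EReal)
    (g : EuclideanSpace ℝ (Fin n) → EReal)
    (K : EuclideanSpace ℝ (Fin p) →L[ℝ] EuclideanSpace ℝ (Fin n))
    (x : EuclideanSpace ℝ (Fin p)) (y : EuclideanSpace ℝ (Fin n)) : EReal :=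
  f x + ((inner ℝ (K x) y : ℝ) : EReal) - conj g y

/-- The primal objective `F(x) = f(x) + g(Kx)`. -/
noncomputable def primalObj (f : EuclideanSpace ℝ (Fin p) → EReal)
    (g : EuclideanSpace ℝ (Fin n) → EReal)
    (K : EuclideanSpace ℝ (Fin p) →L[ℝ] EuclideanSpace ℝ (Fin n))
    (x : EuclideanSpace ℝ (Fin p)) : EReal :=
  f x + g (K x)

/-- The primal optimal value. -/
noncomputable def primalVal (f : EuclideanSpace ℝ (Fin p) → EReal)
    (g : EuclideanSpace ℝ (Fin n) → EReal)
    (K : EuclideanSpace ℝ (Fin p) →L[ℝ] EuclideanSpace ℝ (Fin n)) : EReal :=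
  ⨅ x, primalObj f g K x

/-- The dual objective `D(y) = f*(-Kᵀy) + g*(y)`. -/
noncomputable def dualObj (f : EuclideanSpace ℝ (Fin p) → EReal)
    (g : EuclideanSpace ℝ (Fin n) → EReal)
    (K : EuclideanSpace ℝ (Fin p) →L[ℝ] EuclideanSpace ℝ (Fin n))
    (y : EuclideanSpace ℝ (Fin n)) : EReal :=
  conj f (-(ContinuousLinearMap.adjoint K y)) + conj g y

/-- The dual optimal value (of the minimization form of the dual problem). -/
noncomputable def dualVal (f : EuclideanSpace ℝ (Fin p) → EReal)
    (g : EuclideanSpace ℝ (Fin n) → EReal)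
    (K : EuclideanSpace ℝ (Fin p) →L[ℝ] EuclideanSpace ℝ (Fin n)) : EReal :=
  ⨅ y, dualObj f g K y

/-- `(xs, ys)` is a saddle point of the Lagrangian over `dom f × dom g*`. -/
def IsSaddle (f : EuclideanSpace ℝ (Fin p) → EReal)
    (g : EuclideanSpace ℝ (Fin n) → EReal)
    (K : EuclideanSpace ℝ (Fin p) →L[ℝ] EuclideanSpace ℝ (Fin n))
    (xs : EuclideanSpace ℝ (Fin p)) (ys : EuclideanSpace ℝ (Fin n)) : Prop :=
  xs ∈ effDom f ∧ ys ∈ effDom (conj g) ∧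
    ∀ x ∈ effDom f, ∀ y ∈ effDom (conj g),
      lagr f g K xs y ≤ lagr f g K xs ys ∧ lagr f g K xs ys ≤ lagr f g K x ys

/-- The Slater condition `0 ∈ ri(dom g - K dom f)`. -/
def Slater (f : EuclideanSpace ℝ (Fin p) → EReal)
    (g : EuclideanSpace ℝ (Fin n) → EReal)
    (K : EuclideanSpace ℝ (Fin p) →L[ℝ] EuclideanSpace ℝ (Fin n)) : Prop :=
  (0 : EuclideanSpace ℝ (Fin n)) ∈
    intrinsicInterior ℝ {w | ∃ u ∈ effDom g, ∃ x ∈ effDom f, w = u - K x}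

/-- The gap function `sup {L(x, y') - L(x', y) : x' ∈ X, y' ∈ Y}`. -/
noncomputable def gap (f : EuclideanSpace ℝ (Fin p) → EReal)
    (g : EuclideanSpace ℝ (Fin n) → EReal)
    (K : EuclideanSpace ℝ (Fin p) →L[ℝ] EuclideanSpace ℝ (Fin n))
    (X : Set (EuclideanSpace ℝ (Fin p))) (Y : Set (EuclideanSpace ℝ (Fin n)))
    (x : EuclideanSpace ℝ (Fin p)) (y : EuclideanSpace ℝ (Fin n)) : EReal :=
  ⨆ x' ∈ X, ⨆ y' ∈ Y, lagr f g K x y' - lagr f g K x' y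

end Problem

section Algorithm

variable {p n : ℕ}

/-- `τ₀ = 1`, `τ_{k+1} = (τ_k / 2) (√(τ_k² + 4) - τ_k)`. -/
noncomputable def tauSeq : ℕ → ℝ
  | 0 => 1
  | k + 1 => tauSeq k / 2 * (Real.sqrt (tauSeq k ^ 2 + 4) - tauSeq k)

/-- `β_{k+1} = β_k / (1 + τ_{k+1})`. -/
noncomputable def betaSeq (β₀ : ℝ) (τ : ℕ → ℝ) : ℕ → ℝ
  | 0 => β₀
  | k + 1 => betaSeq β₀ τ k / (1 + τ (k + 1))

/-- `L_k = ‖K‖² / (μ_{g*} + β_k)`, with the operator norm of `K`. -/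
noncomputable def lipSeq (K : EuclideanSpace ℝ (Fin p) →L[ℝ] EuclideanSpace ℝ (Fin n))
    (μg : ℝ) (β : ℕ → ℝ) (k : ℕ) : ℝ :=
  ‖K‖ ^ 2 / (μg + β k)

/-- The momentum step size `etaSeq μf τ L k = η_{k+1}`:
`η_{k+1} = (1 - τ_k) τ_k / (τ_k² + m_{k+1} τ_{k+1})`, `m_{k+1} = (L_{k+1} + μ_f) / (L_k + μ_f)`. -/
noncomputable def etaSeq (μf : ℝ) (τ L : ℕ → ℝ) (k : ℕ) : ℝ :=
  (1 - τ k) * τ k / (τ k ^ 2 + (L (k + 1) + μf) / (L k + μf) * τ (k + 1))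

/-- The sequences `x`, `xh` (extrapolated), `y` (whose entry of index `0` plays no role) and `yt`
(averaged) are generated by the accelerated smoothed gap reduction method ASGARD+ with strong
convexity parameters `μf`, `μg` (of `f` and `g*`), initial smoothness parameter `β₀`, proximal
center `yc` and step sizes `τ`, from the initial points `x 0 ∈ dom f`, `yt 0 ∈ dom g*`. -/
structure IsASGARDPlus (f : EuclideanSpace ℝ (Fin p) → EReal)
    (g : EuclideanSpace ℝ (Fin n) → EReal)
    (K : EuclideanSpace ℝ (Fin p) →L[ℝ] EuclideanSpace ℝ (Fin n))
    (μf μg β₀ : ℝ) (yc : EuclideanSpace ℝ (Fin n)) (τ : ℕ → ℝ)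
    (x xh : ℕ → EuclideanSpace ℝ (Fin p)) (y yt : ℕ → EuclideanSpace ℝ (Fin n)) : Prop where
  x_zero : x 0 ∈ effDom f
  yt_zero : yt 0 ∈ effDom (conj g)
  xh_zero : xh 0 = x 0
  y_succ : ∀ k, IsProx (1 / betaSeq β₀ τ k) (conj g)
    (yc + (1 / betaSeq β₀ τ k) • K (xh k)) (y (k + 1))
  x_succ : ∀ k, IsProx (1 / lipSeq K μg (betaSeq β₀ τ) k) f
    (xh k - (1 / lipSeq K μg (betaSeq β₀ τ) k) • ContinuousLinearMap.adjoint K (y (k + 1)))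
    (x (k + 1))
  xh_succ : ∀ k, xh (k + 1) =
    x (k + 1) + etaSeq μf τ (lipSeq K μg (betaSeq β₀ τ)) k • (x (k + 1) - x k)
  yt_succ : ∀ k, yt (k + 1) = (1 - τ k) • yt k + τ k • y (k + 1)

end Algorithm

end ASGARD

open ASGARD

open ASGARD

/-! ### Decay of the step sizes `tauSeq` and the smoothing parameters `betaSeq`. -/

section Sequences

/-! Replace `g` by its smoothing `max_y ⟨u, y⟩ - g*(y) - β/2 ‖y - yc‖²`, whose gradient composed
with `K` is Lipschitz with constant `‖K‖²/β`. One iteration is then an accelerated proximal gradient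
step whose smoothing is also reduced. `smoothed_gap_estimate` shows by induction that the smoothed
gap at step `k`, tested against any `(w, v)`, plus a quadratic term in `w`, is at most `τ_k² L_0/2
‖x 0 - w‖²`. Two things make the induction close: `(1 - τ_{k+1}) β_k ≤ β_{k+1}` pays for lowering
`β`, and `momentum_bound` pays for raising `L`, using strong convexity through `L_k τ_{k+1}² ≤ μ`.

Removing the smoothing costs `β_k/2 ‖v - yc‖²`, so `tauSeq_le` and `betaSeq_le` turn the estimate
into a bound on `L(x^k, v) - L(w, ỹ^k)` for every `(w, v)` in the domains. The three claims are
choices of `(w, v)`: the supremum over both sets; `w = x*` with `v` a subgradient of `g` at `K x^k`,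
of norm at most `M_g` by `exists_subgradient_norm_le`; and `v = y*` with the supremum over `w` in
`dom f`, a set bounded by `M_{f*}` by `norm_le_of_isLipschitzOnDom_conj`. Weak duality at the saddle
point compares its value with the optimal ones. -/

lemma tauSeq_pos (k : ℕ) : 0 < tauSeq k := by
  induction k with
  | zero => simp [tauSeq]
  | succ k ih =>
    have h : tauSeq k < √(tauSeq k ^ 2 + 4) := Real.lt_sqrt_of_sq_lt (by linarith)
    exact mul_pos (by linarith) (by linarith)

lemma tauSeq_succ_sq (k : ℕ) : tauSeq (k + 1) ^ 2 = (1 - tauSeq (k + 1)) * tauSeq k ^ 2 := by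
  have h : √(tauSeq k ^ 2 + 4) ^ 2 = tauSeq k ^ 2 + 4 := Real.sq_sqrt (by positivity)
  simp only [tauSeq]
  linear_combination tauSeq k ^ 2 / 4 * h

lemma tauSeq_succ_lt_one (k : ℕ) : tauSeq (k + 1) < 1 := by
  have h := tauSeq_succ_sq k
  by_contra hc
  have h1 := pow_pos (tauSeq_pos (k + 1)) 2
  nlinarith [sq_nonneg (tauSeq k)]

lemma tauSeq_le_one (k : ℕ) : tauSeq k ≤ 1 := by
  cases k with
  | zero => simp [tauSeq]
  | succ k => exact (tauSeq_succ_lt_one k).le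

/-- With `s = τ_{k+1}` and `t = τ_k`, the recursion reads `1/s² - 1/s = 1/t²`, that is `(1/s - 1/2)²
= 1/t² + 1/4`, and `1/s > 1/2`. -/
lemma tauSeq_inv_succ (k : ℕ) : 1 / tauSeq k + 1 / 2 ≤ 1 / tauSeq (k + 1) := by
  have h0 := tauSeq_pos k
  have h1 := tauSeq_pos (k + 1)
  have h2 := tauSeq_succ_sq k
  have h4 : tauSeq (k + 1) * (2 + tauSeq k) ≤ 2 * tauSeq k := by
    by_contra! hc
    have h5 := mul_self_lt_mul_self (by positivity) hc
    have h3 := tauSeq_succ_lt_one k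
    nlinarith [mul_pos h0 h1, mul_pos (mul_pos h0 h0) h1, mul_pos (mul_pos h0 h0) h0]
  have : 1 / tauSeq k + 1 / 2 = (2 + tauSeq k) / (2 * tauSeq k) := by field_simp
  rw [this, div_le_div_iff₀ (by positivity) h1]
  linarith

/-- Since `1/τ` grows by at least `1/2` per step, a bound at one index propagates. Starting at `j =
1` permits the shift `c = 2.23`, better than the `c = 2` given by `τ_0 = 1`. -/
lemma tauSeq_le_of_le {j : ℕ} {c : ℝ} (hc : 0 < (j : ℝ) + c) (h : tauSeq j ≤ 2 / (j + c))
    (k : ℕ) (hk : j ≤ k) : tauSeq k ≤ 2 / (k + c) := by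
  have key : ((k : ℝ) + c) / 2 ≤ 1 / tauSeq k := by
    induction k, hk using Nat.le_induction with
    | base =>
      have := one_div_le_one_div_of_le (tauSeq_pos j) h
      rwa [one_div_div] at this
    | succ k hk ih =>
      have := tauSeq_inv_succ k
      push_cast
      linarith
  have hkj : (j : ℝ) ≤ k := by exact_mod_cast hk
  have := one_div_le_one_div_of_le (by linarith) key
  rwa [one_div_div, div_one, one_div_div] at this

lemma tauSeq_le (k : ℕ) : tauSeq k ≤ 2 / (k + 2) :=
  tauSeq_le_of_le (j := 0) (by norm_num) (by simp [tauSeq]) k k.zero_le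

lemma tauSeq_one_sq : tauSeq 1 ^ 2 = 1 - tauSeq 1 := by
  simpa [tauSeq] using tauSeq_succ_sq 0

lemma tauSeq_one_le : tauSeq 1 ≤ 0.61804 := by
  nlinarith [tauSeq_one_sq, tauSeq_pos 1]

lemma tauSeq_one_ge : 0.618 ≤ tauSeq 1 := by
  nlinarith [tauSeq_one_sq, tauSeq_pos 1]

/-- This is what keeps `L_k τ_{k+1}²` from increasing with `k`. It amounts to `τ_k (1 - τ_{k+1}) ≤
τ_{k+1}`, whose square follows from the recursion. -/
lemma one_add_tauSeq_mul_le (k : ℕ) : (1 + tauSeq k) * (1 - tauSeq (k + 1)) ≤ 1 := by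
  have h0 := tauSeq_pos k
  have h1 := tauSeq_pos (k + 1)
  have h2 := tauSeq_succ_sq k
  have h3 := tauSeq_succ_lt_one k
  have h4 : tauSeq k * (1 - tauSeq (k + 1)) ≤ tauSeq (k + 1) := by
    refine abs_le_of_sq_le_sq' ?_ h1.le |>.2
    nlinarith [mul_nonneg (sq_nonneg (tauSeq k)) (mul_nonneg h1.le (sub_nonneg.2 h3.le))]
  linarith

variable {β₀ : ℝ}

lemma betaSeq_pos (h : 0 < β₀) (k : ℕ) : 0 < betaSeq β₀ tauSeq k := by
  induction k with
  | zero => exact h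
  | succ k ih => exact div_pos ih (by linarith [tauSeq_pos (k + 1)])

lemma betaSeq_succ_mul (k : ℕ) :
    betaSeq β₀ tauSeq (k + 1) * (1 + tauSeq (k + 1)) = betaSeq β₀ tauSeq k :=
  div_mul_cancel₀ _ (by linarith [tauSeq_pos (k + 1)])

lemma one_sub_mul_betaSeq_le (h : 0 < β₀) (k : ℕ) :
    (1 - tauSeq (k + 1)) * betaSeq β₀ tauSeq k ≤ betaSeq β₀ tauSeq (k + 1) := by
  have h1 := betaSeq_pos h (k + 1)
  rw [← betaSeq_succ_mul]
  nlinarith [mul_nonneg h1.le (sq_nonneg (tauSeq (k + 1)))]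

/-- The ratio `β_k / τ_k²` is multiplied at each step by `1 / (1 - τ_{k+1}²)`. With `τ_{k+1} ≤ 2/(k
+ 3.23)` this factor is at most `(k + 3.23)² / ((k + 1.23)(k + 5.23))`, and the product of these
telescopes to the stated fraction. The constant `5` is what the case `k = 1` allows; the shift `2`
in place of `2.23` would need a larger one. -/
lemma betaSeq_le_mul_tauSeq_sq (h : 0 < β₀) (k : ℕ) (hk : 1 ≤ k) :
    betaSeq β₀ tauSeq k ≤ β₀ * (5 * ((k + 1.23) * (k + 2.23) / ((k + 3.23) * (k + 4.23)))) *
      tauSeq k ^ 2 := by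
  induction k, hk using Nat.le_induction with
  | base =>
    have h1 := betaSeq_succ_mul (β₀ := β₀) 0
    have h0 : betaSeq β₀ tauSeq 0 = β₀ := rfl
    simp only [zero_add, h0] at h1
    have ht := tauSeq_one_ge
    have hs := tauSeq_one_sq
    have ht' := tauSeq_one_le
    have hb := betaSeq_pos h 1
    have : (1:ℝ) ≤ (1 + tauSeq 1) * ((5 * ((1 + 1.23) * (1 + 2.23) / ((1 + 3.23) * (1 + 4.23)))) *
      tauSeq 1 ^ 2) := by
      rw [hs]
      have : (1 + tauSeq 1) * (1 - tauSeq 1) = tauSeq 1 := by linear_combination -hs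
      calc (1:ℝ) ≤ (5 * ((1 + 1.23) * (1 + 2.23) / ((1 + 3.23) * (1 + 4.23)))) * tauSeq 1 := by
            norm_num; linarith
        _ = _ := by rw [mul_left_comm, this]
    rw [Nat.cast_one, mul_assoc]
    nth_rw 2 [← h1]
    rw [mul_assoc]
    exact le_mul_of_one_le_right hb.le this
  | succ k hk ih =>
    have ht := tauSeq_pos (k + 1)
    have hs := tauSeq_succ_sq k
    have hk1 : (1 : ℝ) ≤ k := by exact_mod_cast hk
    have hle : tauSeq (k + 1) ≤ 2 / ((k + 1 : ℕ) + 2.23) := by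
      refine tauSeq_le_of_le (j := 1) (by norm_num) ?_ _ (by omega)
      refine tauSeq_one_le.trans ?_
      norm_num
    push_cast at hle ⊢
    have hl := tauSeq_succ_lt_one k
    rw [le_div_iff₀ (by positivity)] at hle
    have hb := betaSeq_succ_mul (β₀ := β₀) k
    have e1 : (1 - tauSeq (k + 1)) * betaSeq β₀ tauSeq k ≤
        β₀ * (5 * ((k + 1.23) * (k + 2.23) / ((k + 3.23) * (k + 4.23)))) * tauSeq (k + 1) ^ 2 := by
      rw [hs]
      calc _ ≤ (1 - tauSeq (k + 1)) * _ := mul_le_mul_of_nonneg_left ih (by linarith)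
        _ = _ := by ring
    rw [← hb] at e1
    have e2 : ((k + 3.23 : ℝ) ^ 2 - 4) * betaSeq β₀ tauSeq (k + 1) ≤
        (k + 3.23) ^ 2 * ((1 - tauSeq (k + 1)) * (betaSeq β₀ tauSeq (k + 1) *
          (1 + tauSeq (k + 1)))) := by
      have hle2 : (tauSeq (k + 1) * (k + 3.23)) ^ 2 ≤ 2 ^ 2 := by
        have : tauSeq (k + 1) * (k + 3.23) ≤ 2 := by norm_num at hle ⊢; linarith
        exact pow_le_pow_left₀ (by positivity) this 2
      nlinarith [mul_le_mul_of_nonneg_left hle2 (betaSeq_pos h (k + 1)).le]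
    have e3 := e2.trans (mul_le_mul_of_nonneg_left e1 (by positivity))
    have hpos : (0 : ℝ) < (k + 3.23) ^ 2 - 4 := by nlinarith
    refine le_of_mul_le_mul_left (e3.trans_eq ?_) hpos
    have : ((k : ℝ) + 3.23) ^ 2 - 4 = (k + 1.23) * (k + 5.23) := by ring
    rw [this]
    have a1 : (k : ℝ) + 1 + 1.23 = k + 2.23 := by ring
    have a2 : (k : ℝ) + 1 + 2.23 = k + 3.23 := by ring
    have a3 : (k : ℝ) + 1 + 3.23 = k + 4.23 := by ring
    have a4 : (k : ℝ) + 1 + 4.23 = k + 5.23 := by ring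
    rw [a1, a2, a3, a4]
    field_simp

lemma betaSeq_le (h : 0 < β₀) (k : ℕ) : betaSeq β₀ tauSeq k ≤ 20 * β₀ / (k + 4) ^ 2 := by
  rcases Nat.eq_zero_or_pos k with rfl | hk
  · simp only [betaSeq]; norm_num; linarith
  have hle : tauSeq k ≤ 2 / (k + 2.23) := by
    refine tauSeq_le_of_le (j := 1) (by norm_num) ?_ _ hk
    exact tauSeq_one_le.trans (by norm_num)
  have hk0 : (1 : ℝ) ≤ k := by exact_mod_cast hk
  calc betaSeq β₀ tauSeq k
      ≤ β₀ * (5 * ((k + 1.23) * (k + 2.23) / ((k + 3.23) * (k + 4.23)))) * tauSeq k ^ 2 :=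
        betaSeq_le_mul_tauSeq_sq h k hk
    _ ≤ β₀ * (5 * ((k + 1.23) * (k + 2.23) / ((k + 3.23) * (k + 4.23)))) * (2 / (k + 2.23)) ^ 2 := by
        have := (tauSeq_pos k).le
        gcongr
    _ = 20 * β₀ * ((k + 1.23) / ((k + 2.23) * (k + 3.23) * (k + 4.23))) := by field_simp; norm_num
    _ ≤ 20 * β₀ * (1 / (k + 4) ^ 2) := by
        refine mul_le_mul_of_nonneg_left ?_ (by positivity)
        rw [div_le_div_iff₀ (by positivity) (by positivity)]
        nlinarith [sq_nonneg (k : ℝ)]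
    _ = _ := by ring

end Sequences

/-! ### One primal-dual step and the momentum inequality. -/

section ProxInequality

variable {E F : Type*} [NormedAddCommGroup E] [InnerProductSpace ℝ E]
  [NormedAddCommGroup F] [InnerProductSpace ℝ F]

lemma norm_combo_sub_sq (a b : ℝ) (hab : a + b = 1) (u v c : E) :
    ‖a • u + b • v - c‖ ^ 2 = a * ‖u - c‖ ^ 2 + b * ‖v - c‖ ^ 2 - a * b * ‖u - v‖ ^ 2 := by
  have h1 : a • u + b • v - c = a • (u - c) + b • (v - c) := by
    obtain rfl : b = 1 - a := by linarith
    module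
  have h2 : u - v = (u - c) - (v - c) := by abel
  rw [h1, h2]
  generalize u - c = U
  generalize v - c = V
  rw [norm_add_sq_real, norm_sub_sq_real, norm_smul, norm_smul, inner_smul_left,
    inner_smul_right, mul_pow, mul_pow, Real.norm_eq_abs, Real.norm_eq_abs, sq_abs, sq_abs]
  simp only [conj_trivial]
  obtain rfl : b = 1 - a := by linarith
  ring

lemma StrongConvexOn.prox_three_point {S : Set E} {φ : E → ℝ} {μ L : ℝ}
    (hφ : StrongConvexOn S μ φ) {c z w : E} (hz : z ∈ S) (hw : w ∈ S)
    (hmin : ∀ w ∈ S, φ z + L / 2 * ‖z - c‖ ^ 2 ≤ φ w + L / 2 * ‖w - c‖ ^ 2) :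
    φ z + L / 2 * ‖z - c‖ ^ 2 + (L + μ) / 2 * ‖w - z‖ ^ 2 ≤ φ w + L / 2 * ‖w - c‖ ^ 2 := by
  -- Minimality is tested at `t w + (1 - t) z` and divided by `t`; the lost factor `1 - t`
  -- disappears as `t → 0`.
  have key : ∀ t : ℝ, 0 < t → t < 1 →
      φ z + L / 2 * ‖z - c‖ ^ 2 + (L + μ) / 2 * ‖w - z‖ ^ 2 * (1 - t)
        ≤ φ w + L / 2 * ‖w - c‖ ^ 2 := by
    intro t ht ht1
    have hab : t + (1 - t) = 1 := by ring
    have h1 := hφ.2 hw hz ht.le (sub_nonneg.2 ht1.le) hab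
    have h2 := hmin _ (hφ.1 hw hz ht.le (sub_nonneg.2 ht1.le) hab)
    rw [norm_combo_sub_sq _ _ hab] at h2
    simp only [smul_eq_mul] at h1
    refine le_of_mul_le_mul_left ?_ ht
    nlinarith
  have hlim : Filter.Tendsto (fun t : ℝ => φ z + L / 2 * ‖z - c‖ ^ 2 +
      (L + μ) / 2 * ‖w - z‖ ^ 2 * (1 - t)) (nhdsWithin 0 (Set.Ioi 0))
      (nhds (φ z + L / 2 * ‖z - c‖ ^ 2 + (L + μ) / 2 * ‖w - z‖ ^ 2 * (1 - 0))) :=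
    (Continuous.tendsto (by fun_prop) 0).mono_left nhdsWithin_le_nhds
  rw [sub_zero, mul_one] at hlim
  refine le_of_tendsto hlim ?_
  filter_upwards [Ioo_mem_nhdsGT (zero_lt_one' ℝ)] with t ht using key t ht.1 ht.2

lemma inner_map_le_of_young (K : E →L[ℝ] F) {β : ℝ} (hβ : 0 < β) (d : E) (v : F) :
    inner ℝ (K d) v ≤ ‖K‖ ^ 2 / β / 2 * ‖d‖ ^ 2 + β / 2 * ‖v‖ ^ 2 := by
  have h1 : inner ℝ (K d) v ≤ ‖K‖ * ‖d‖ * ‖v‖ :=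
    (real_inner_le_norm _ _).trans (mul_le_mul_of_nonneg_right (K.le_opNorm d) (norm_nonneg v))
  have h2 : 0 ≤ (‖K‖ * ‖d‖ - β * ‖v‖) ^ 2 / (2 * β) := by positivity
  have h3 : (‖K‖ * ‖d‖ - β * ‖v‖) ^ 2 / (2 * β) =
      ‖K‖ ^ 2 / β / 2 * ‖d‖ ^ 2 + β / 2 * ‖v‖ ^ 2 - ‖K‖ * ‖d‖ * ‖v‖ := by
    field_simp
    ring
  linarith

/-- The descent inequality of one primal-dual step: `y₁` is the maximizer of the smoothed
dual function at `xh`, and `x₁` the following proximal gradient step. -/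
lemma smoothed_descent (K : E →L[ℝ] F) {S : Set E} {T : Set F} {φ : E → ℝ} {γ : F → ℝ}
    {β μ : ℝ} (hβ : 0 < β) {xh x₁ : E} {y₁ yc : F}
    (hy : ∀ y ∈ T, inner ℝ (K xh) y - γ y - β / 2 * ‖y - yc‖ ^ 2 + β / 2 * ‖y - y₁‖ ^ 2 ≤
      inner ℝ (K xh) y₁ - γ y₁ - β / 2 * ‖y₁ - yc‖ ^ 2)
    (hx : ∀ w ∈ S, φ x₁ + inner ℝ (K x₁) y₁ + ‖K‖ ^ 2 / β / 2 * ‖x₁ - xh‖ ^ 2 +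
      (‖K‖ ^ 2 / β + μ) / 2 * ‖w - x₁‖ ^ 2 ≤
      φ w + inner ℝ (K w) y₁ + ‖K‖ ^ 2 / β / 2 * ‖w - xh‖ ^ 2)
    {w : E} {y : F} (hw : w ∈ S) (hyT : y ∈ T) :
    φ x₁ + inner ℝ (K x₁) y - γ y - β / 2 * ‖y - yc‖ ^ 2 ≤
      φ w + inner ℝ (K w) y₁ - γ y₁ - β / 2 * ‖y₁ - yc‖ ^ 2 + ‖K‖ ^ 2 / β / 2 * ‖w - xh‖ ^ 2 -
        (‖K‖ ^ 2 / β + μ) / 2 * ‖w - x₁‖ ^ 2 := by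
  have h1 := hy y hyT
  have h2 := hx w hw
  -- Passing from `K xh` to `K x₁` costs this cross term, and the two squares bounding it are
  -- exactly the surpluses in `h1` and `h2`.
  have h3 := inner_map_le_of_young K hβ (x₁ - xh) (y - y₁)
  simp only [map_sub, inner_sub_left, inner_sub_right] at h3
  linarith

/-- In the application `e = w - x^{k+1}`, `d = x^{k+1} - x^k`, `t = τ_k`, `s = τ_{k+1}`, `L = L_k`,
`P = L_{k+1}`. The left side is the extrapolation error less the strong convexity gain, the right
side the quadratic term carried over from the previous step. After extracting `s²`, the value of `c`
makes `(L + μ) c = P + q` with `q = μ - L s²`, so the difference of the two sides splits into three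
terms that are nonnegative because `q ≥ 0` and `c ≥ 1`. -/
lemma momentum_bound (e d : E) {L μ t s b c η m P : ℝ} (hL : 0 ≤ L) (hs : 0 < s) (hs1 : s ≤ 1)
    (hts : s ^ 2 = (1 - s) * t ^ 2) (hb : η = s * b) (hc : 1 - t = t * (c * b))
    (hc' : c = s + m * (1 - s)) (hm : m * (L + μ) = L * (1 + s) + μ) (hm1 : 1 ≤ m)
    (hμ : L * s ^ 2 ≤ μ) (hP : P = L * (1 + s)) :
    P / 2 * ‖s • e - η • d‖ ^ 2 - μ * (s * (1 - s)) / 2 * ‖e‖ ^ 2 ≤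
      (1 - s) * ((L + μ) / 2 * ‖t • e - (1 - t) • d‖ ^ 2) := by
  subst hP
  have h1 : s • e - η • d = s • (e - b • d) := by rw [hb]; module
  have h2 : t • e - (1 - t) • d = t • (e - (c * b) • d) := by rw [hc]; module
  have hc1 : 1 ≤ c := by rw [hc']; nlinarith
  have hPc : (L + μ) * c = L * (1 + s) + (μ - L * s ^ 2) := by
    rw [hc']; linear_combination (1 - s) * hm
  have hsq : 0 ≤ ‖e - b • d‖ ^ 2 := by positivity
  rw [h1, h2, norm_smul, norm_smul, mul_pow, mul_pow, Real.norm_eq_abs, Real.norm_eq_abs,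
    sq_abs, sq_abs]
  have e1 : (1 - s) * ((L + μ) / 2 * (t ^ 2 * ‖e - (c * b) • d‖ ^ 2)) =
      s ^ 2 * ((L + μ) / 2 * ‖e - (c * b) • d‖ ^ 2) := by rw [hts]; ring
  rw [e1]
  have x1 : ‖e - (c * b) • d‖ ^ 2 = ‖e‖ ^ 2 - 2 * (c * b) * inner ℝ e d + (c * b) ^ 2 * ‖d‖ ^ 2 := by
    rw [norm_sub_sq_real, norm_smul, inner_smul_right, mul_pow, Real.norm_eq_abs, sq_abs]; ring
  have x2 : ‖e - b • d‖ ^ 2 = ‖e‖ ^ 2 - 2 * b * inner ℝ e d + b ^ 2 * ‖d‖ ^ 2 := by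
    rw [norm_sub_sq_real, norm_smul, inner_smul_right, mul_pow, Real.norm_eq_abs, sq_abs]; ring
  rw [x2] at hsq ⊢
  rw [x1]
  set A := ‖e‖ ^ 2
  set B := inner ℝ e d
  set D := ‖d‖ ^ 2
  have hA : 0 ≤ A := by positivity
  have hD : 0 ≤ D := by positivity
  set q := μ - L * s ^ 2 with hq
  have hq0 : 0 ≤ q := by linarith
  have hid : s ^ 2 * ((L + μ) / 2 * (A - 2 * (c * b) * B + (c * b) ^ 2 * D)) -
      (L * (1 + s) / 2 * (s ^ 2 * (A - 2 * b * B + b ^ 2 * D)) - μ * (s * (1 - s)) / 2 * A) =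
      s ^ 2 / 2 * (q * (A - 2 * b * B + b ^ 2 * D)) + s / 2 * (1 - s) * q * A +
      s ^ 2 / 2 * ((c - 1) * (L * (1 + s) + q) * b ^ 2 * D) := by
    have : (c * b) ^ 2 * (L + μ) = c * b ^ 2 * (L * (1 + s) + q) := by rw [← hPc]; ring
    have h' : μ = q + L * s ^ 2 := by rw [hq]; ring
    linear_combination (-(s ^ 2 * b * B)) * hPc + s ^ 2 / 2 * D * this + s / 2 * A * h'
  have n1 : 0 ≤ s ^ 2 / 2 * (q * (A - 2 * b * B + b ^ 2 * D)) := by positivity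
  have n2 : 0 ≤ s / 2 * (1 - s) * q * A := by
    have : 0 ≤ 1 - s := by linarith
    positivity
  have n3 : 0 ≤ s ^ 2 / 2 * ((c - 1) * (L * (1 + s) + q) * b ^ 2 * D) := by
    have : 0 ≤ c - 1 := by linarith
    positivity
  linarith

end ProxInequality

/-! ### The accelerated induction. -/

section Estimate

variable {E F : Type*} [NormedAddCommGroup E] [InnerProductSpace ℝ E]
  [NormedAddCommGroup F] [InnerProductSpace ℝ F]

/-- The left side does not increase with `k`, so only `k = 0` constrains `β₀`; there `τ_1² = 1 - τ_1
≤ 0.382`, the source of that constant. -/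
lemma kappa_tauSeq_sq_le {κ μ β₀ : ℝ} (hκ : 0 ≤ κ) (hμ : 0 < μ) (hβ : 0 < β₀)
    (h : 0.382 * κ / μ ≤ β₀) (k : ℕ) :
    κ / betaSeq β₀ tauSeq k * tauSeq (k + 1) ^ 2 ≤ μ := by
  induction k with
  | zero =>
    have h1 : tauSeq 1 ^ 2 ≤ 0.382 := by linarith [tauSeq_one_sq, tauSeq_one_ge]
    have h2 : betaSeq β₀ tauSeq 0 = β₀ := rfl
    rw [div_le_iff₀ hμ] at h
    rw [h2, div_mul_eq_mul_div, div_le_iff₀ hβ]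
    nlinarith
  | succ k ih =>
    have hb := betaSeq_succ_mul (β₀ := β₀) k
    have hb0 := betaSeq_pos hβ (k + 1)
    have ht := tauSeq_pos (k + 1)
    rw [tauSeq_succ_sq (k + 1)]
    have e : κ / betaSeq β₀ tauSeq (k + 1) = κ / betaSeq β₀ tauSeq k * (1 + tauSeq (k + 1)) := by
      rw [← hb]; field_simp
    have n : 0 ≤ κ / betaSeq β₀ tauSeq k * tauSeq (k + 1) ^ 2 := by
      have := betaSeq_pos hβ k
      positivity
    rw [e]
    nlinarith [mul_le_mul_of_nonneg_left (one_add_tauSeq_mul_le (k + 1)) n]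

/-- This puts the momentum parameter in the form required by `momentum_bound`: by the recursion, the
denominator `τ_k² + m τ_{k+1}` equals `τ_k² c / τ_{k+1}` with `c = τ_{k+1} + m (1 - τ_{k+1})`. -/
lemma etaSeq_relation {μ : ℝ} {L : ℕ → ℝ} (hμ : 0 < μ) (hL : ∀ k, 0 ≤ L k) (k : ℕ) :
    1 - tauSeq k = tauSeq k * ((tauSeq (k + 1) + (L (k + 1) + μ) / (L k + μ) *
      (1 - tauSeq (k + 1))) * (etaSeq μ tauSeq L k / tauSeq (k + 1))) := by
  have ht := tauSeq_pos k
  have hs := tauSeq_pos (k + 1)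
  have h := tauSeq_succ_sq k
  have hm : 0 < (L (k + 1) + μ) / (L k + μ) := by
    have := hL k
    have := hL (k + 1)
    positivity
  unfold etaSeq
  generalize (L (k + 1) + μ) / (L k + μ) = m at *
  have hd : tauSeq k ^ 2 + m * tauSeq (k + 1) ≠ 0 := by positivity
  field_simp
  linear_combination (1 - tauSeq k) * m * h

/-- The accelerated estimate for the smoothed gap along the iterations, for real-valued
`φ` and `γ` on convex sets `S` and `T`. -/
theorem smoothed_gap_estimate (K : E →L[ℝ] F) {S : Set E} {T : Set F} {φ : E → ℝ}
    {γ : F → ℝ} {μ β₀ : ℝ} (hμ : 0 < μ) (hβ : 0 < β₀) (hβ₀ : 0.382 * ‖K‖ ^ 2 / μ ≤ β₀)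
    (hφ : StrongConvexOn S μ φ) (hγ : ConvexOn ℝ T γ) {yc : F}
    {x xh : ℕ → E} {y yt : ℕ → F} {β L : ℕ → ℝ} (hβs : β = betaSeq β₀ tauSeq)
    (hLs : ∀ k, L k = ‖K‖ ^ 2 / β k)
    (hyT : ∀ k, y (k + 1) ∈ T) (hytT : ∀ k, yt k ∈ T) (hxS : ∀ k, x k ∈ S)
    (hy : ∀ k, ∀ v ∈ T,
      inner ℝ (K (xh k)) v - γ v - β k / 2 * ‖v - yc‖ ^ 2 + β k / 2 * ‖v - y (k + 1)‖ ^ 2 ≤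
      inner ℝ (K (xh k)) (y (k + 1)) - γ (y (k + 1)) - β k / 2 * ‖y (k + 1) - yc‖ ^ 2)
    (hx : ∀ k, ∀ w ∈ S, φ (x (k + 1)) + inner ℝ (K (x (k + 1))) (y (k + 1)) +
      L k / 2 * ‖x (k + 1) - xh k‖ ^ 2 + (L k + μ) / 2 * ‖w - x (k + 1)‖ ^ 2 ≤
      φ w + inner ℝ (K w) (y (k + 1)) + L k / 2 * ‖w - xh k‖ ^ 2)
    (hxh0 : xh 0 = x 0)
    (hxh : ∀ k, xh (k + 1) = x (k + 1) + etaSeq μ tauSeq L k • (x (k + 1) - x k))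
    (hyt : ∀ k, yt (k + 1) = (1 - tauSeq k) • yt k + tauSeq k • y (k + 1))
    (k : ℕ) : ∀ w ∈ S, ∀ v ∈ T,
      φ (x (k + 1)) + inner ℝ (K (x (k + 1))) v - γ v - β k / 2 * ‖v - yc‖ ^ 2 -
        (φ w + inner ℝ (K w) (yt (k + 1)) - γ (yt (k + 1))) +
        (L k + μ) / 2 * ‖(1 - tauSeq k) • x k + tauSeq k • w - x (k + 1)‖ ^ 2 ≤
      tauSeq k ^ 2 * (L 0 / 2 * ‖x 0 - w‖ ^ 2) := by
  have hβp : ∀ k, 0 < β k := fun k => hβs ▸ betaSeq_pos hβ k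
  have hL0 : ∀ k, 0 ≤ L k := fun k => by
    have := hβp k
    rw [hLs]; positivity
  have hdesc : ∀ k, ∀ w ∈ S, ∀ v ∈ T, _ := fun k w hw v hv =>
    smoothed_descent K (hβp k) (hy k) (by simpa only [hLs] using hx k) hw hv
  simp only [← hLs] at hdesc
  induction k with
  | zero =>
    intro w hw v hv
    have h1 := hdesc 0 w hw v hv
    have h2 := hyt 0
    -- Because `τ_0 = 1`, the first averages forget `yt 0` and `x 0`.
    have h3 : tauSeq 0 = 1 := rfl
    have h4 : 0 ≤ β 0 / 2 * ‖y 1 - yc‖ ^ 2 := by have := hβp 0; positivity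
    simp only [h3, sub_self, zero_smul, one_smul, zero_add, one_pow, one_mul] at h2 ⊢
    rw [h2, norm_sub_rev (x 0)]
    simp only [zero_add, hxh0] at h1
    linarith
  | succ k ih =>
    intro w hw v hv
    have hs := tauSeq_pos (k + 1)
    have hs1 := tauSeq_le_one (k + 1)
    have hab : (1 - tauSeq (k + 1)) + tauSeq (k + 1) = 1 := by ring
    have hcv := hφ.2 (hxS (k + 1)) hw (sub_nonneg.2 hs1) hs.le hab
    have hw' := hφ.1 (hxS (k + 1)) hw (sub_nonneg.2 hs1) hs.le hab
    have h1 := hdesc (k + 1) _ hw' v hv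
    -- The hypothesis is used at the new dual iterate, not at `v`: the descent inequality has
    -- already replaced `v` by `y (k + 2)` on its right side.
    have h2 := ih w hw (y (k + 2)) (hyT (k + 1))
    have hcγ := hγ.2 (hytT (k + 1)) (hyT (k + 1)) (sub_nonneg.2 hs1) hs.le hab
    rw [← hyt (k + 1)] at hcγ
    have hin : inner ℝ (K w) (yt (k + 2)) = (1 - tauSeq (k + 1)) * inner ℝ (K w) (yt (k + 1)) +
        tauSeq (k + 1) * inner ℝ (K w) (y (k + 2)) := by
      rw [hyt (k + 1), inner_add_right, inner_smul_right, inner_smul_right]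
    have hin2 : inner ℝ (K ((1 - tauSeq (k + 1)) • x (k + 1) + tauSeq (k + 1) • w)) (y (k + 2)) =
        (1 - tauSeq (k + 1)) * inner ℝ (K (x (k + 1))) (y (k + 2)) +
        tauSeq (k + 1) * inner ℝ (K w) (y (k + 2)) := by
      rw [map_add, map_smul, map_smul, inner_add_left, real_inner_smul_left, real_inner_smul_left]
    have hβstep : (1 - tauSeq (k + 1)) * β k ≤ β (k + 1) :=
      hβs ▸ one_sub_mul_betaSeq_le hβ k
    have hLstep : L (k + 1) = L k * (1 + tauSeq (k + 1)) := by
      have hb : β (k + 1) * (1 + tauSeq (k + 1)) = β k := hβs ▸ betaSeq_succ_mul k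
      have := hβp (k + 1)
      rw [hLs, hLs, ← hb]
      field_simp
    have hμL : L k * tauSeq (k + 1) ^ 2 ≤ μ := by
      rw [hLs, hβs]
      exact kappa_tauSeq_sq_le (by positivity) hμ hβ hβ₀ k
    have hLk := hL0 k
    have hmom := momentum_bound (w - x (k + 1)) (x (k + 1) - x k) (t := tauSeq k)
      (b := etaSeq μ tauSeq L k / tauSeq (k + 1)) (η := etaSeq μ tauSeq L k) hLk hs hs1
      (tauSeq_succ_sq k) (by field_simp) (etaSeq_relation hμ hL0 k) rfl
      (by rw [div_mul_cancel₀ _ (by positivity), hLstep])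
      (by rw [one_le_div (by positivity), hLstep]; nlinarith) hμL hLstep
    have v1 : tauSeq (k + 1) • (w - x (k + 1)) - etaSeq μ tauSeq L k • (x (k + 1) - x k) =
        (1 - tauSeq (k + 1)) • x (k + 1) + tauSeq (k + 1) • w - xh (k + 1) := by
      rw [hxh]; module
    have v2 : tauSeq k • (w - x (k + 1)) - (1 - tauSeq k) • (x (k + 1) - x k) =
        (1 - tauSeq k) • x k + tauSeq k • w - x (k + 1) := by module
    rw [v1, v2] at hmom
    rw [hin2] at h1
    simp only [smul_eq_mul] at hcv hcγ
    rw [norm_sub_rev (x (k + 1)) w] at hcv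
    have h2' := mul_le_mul_of_nonneg_left h2 (sub_nonneg.2 hs1)
    have h3 := mul_le_mul_of_nonneg_right hβstep
      (show 0 ≤ ‖y (k + 2) - yc‖ ^ 2 / 2 by positivity)
    rw [tauSeq_succ_sq k, hin]
    linarith

end Estimate

/-! ### From extended-real to real functions; conjugates, proximal points and subgradients. -/

section ExtendedReal

lemma coe_toReal_of_mem_effDom {E : Type*} {f : E → EReal} (hf : ∀ x, f x ≠ ⊥) {x : E}
    (hx : x ∈ effDom f) :
    ((f x).toReal : EReal) = f x :=
  EReal.coe_toReal (ne_of_lt hx) (hf x)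

lemma eq_top_of_notMem_effDom {E : Type*} {f : E → EReal} {x : E} (hx : x ∉ effDom f) :
    f x = ⊤ :=
  not_lt_top_iff.1 hx

lemma ASGARD.IsProx.toReal_le {E : Type*} [NormedAddCommGroup E] {h : E → EReal} (hh : ∀ x, h x ≠ ⊥)
    {L : ℝ} {c z : E} (hz : IsProx (1 / L) h c z) {w : E} (hw : w ∈ effDom h) :
    (h z).toReal + L / 2 * ‖z - c‖ ^ 2 ≤ (h w).toReal + L / 2 * ‖w - c‖ ^ 2 := by
  have h1 := hz.2 w hw
  have h2 : 1 / (2 * (1 / L)) = L / 2 := by rw [mul_one_div, one_div_div]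
  rw [← coe_toReal_of_mem_effDom hh hz.1, ← coe_toReal_of_mem_effDom hh hw, h2,
    ← EReal.coe_add, ← EReal.coe_add] at h1
  exact EReal.coe_le_coe_iff.1 h1

variable {E : Type*} [NormedAddCommGroup E] [InnerProductSpace ℝ E]

lemma ASGARD.IsConvexFn.convexOn_toReal {f : E → EReal} (hc : IsConvexFn f) (hf : ∀ x, f x ≠ ⊥) :
    ConvexOn ℝ (effDom f) fun x => (f x).toReal := by
  have key : ∀ ⦃u⦄, u ∈ effDom f → ∀ ⦃v⦄, v ∈ effDom f → ∀ ⦃a b : ℝ⦄, 0 ≤ a → 0 ≤ b → a + b = 1 →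
      f (a • u + b • v) ≤ ((a * (f u).toReal + b * (f v).toReal : ℝ) : EReal) := by
    intro u hu v hv a b ha hb hab
    exact hc (x := (u, (f u).toReal)) (coe_toReal_of_mem_effDom hf hu).ge
      (y := (v, (f v).toReal)) (coe_toReal_of_mem_effDom hf hv).ge ha hb hab
  refine ⟨fun u hu v hv a b ha hb hab =>
    (key hu hv ha hb hab).trans_lt (EReal.coe_lt_top _), fun u hu v hv a b ha hb hab => ?_⟩
  have h := key hu hv ha hb hab
  have hm : a • u + b • v ∈ effDom f := h.trans_lt (EReal.coe_lt_top _)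
  rw [← coe_toReal_of_mem_effDom hf hm] at h
  exact EReal.coe_le_coe_iff.1 h

lemma ASGARD.IsStronglyConvexFn.strongConvexOn_toReal {f : E → EReal} {μ : ℝ}
    (hc : IsStronglyConvexFn μ f) (hf : ∀ x, f x ≠ ⊥) :
    StrongConvexOn (effDom f) μ fun x => (f x).toReal := by
  rw [strongConvexOn_iff_convex]
  have hd : effDom (fun x => f x - ((μ / 2 * ‖x‖ ^ 2 : ℝ) : EReal)) = effDom f := by
    ext x
    simp only [effDom, Set.mem_ofPred_eq]
    induction h : f x with
    | bot => exact absurd h (hf x)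
    | top => simp only [EReal.top_sub_coe]
    | coe r => simp only [← EReal.coe_sub, EReal.coe_lt_top]
  have h := IsConvexFn.convexOn_toReal hc fun x => by
    induction h : f x with
    | bot => exact absurd h (hf x)
    | top => simp only [EReal.top_sub_coe]; exact top_ne_bot
    | coe r => simp only [← EReal.coe_sub]; exact EReal.coe_ne_bot _
  rw [hd] at h
  refine h.congr fun x hx => ?_
  simp only
  rw [← coe_toReal_of_mem_effDom hf hx, ← EReal.coe_sub, EReal.toReal_coe, EReal.toReal_coe]

lemma conj_ne_bot {g : E → EReal} (hg : (effDom g).Nonempty) (y : E) : conj g y ≠ ⊥ := by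
  obtain ⟨x, hx⟩ := hg
  have h : ((inner ℝ y x : ℝ) : EReal) - g x ≤ conj g y :=
    le_iSup (fun x => ((inner ℝ y x : ℝ) : EReal) - g x) x
  refine ne_bot_of_le_ne_bot ?_ h
  have hx' : g x ≠ ⊤ := ne_of_lt hx
  induction h : g x with
  | bot => simp
  | top => exact absurd h hx'
  | coe r => simp only [← EReal.coe_sub]; exact EReal.coe_ne_bot _

lemma conj_le_coe_iff {g : E → EReal} (hg : ∀ x, g x ≠ ⊥) {y : E} {c : ℝ} :
    conj g y ≤ c ↔ ∀ x ∈ effDom g, inner ℝ y x - (g x).toReal ≤ c := by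
  rw [conj, iSup_le_iff]
  refine forall_congr' fun x => ⟨fun h hx => ?_, fun h => ?_⟩
  · rw [← coe_toReal_of_mem_effDom hg hx, ← EReal.coe_sub] at h
    exact EReal.coe_le_coe_iff.1 h
  · by_cases hx : x ∈ effDom g
    · rw [← coe_toReal_of_mem_effDom hg hx, ← EReal.coe_sub]
      exact EReal.coe_le_coe_iff.2 (h hx)
    · rw [eq_top_of_notMem_effDom hx]
      simp

lemma isConvexFn_conj {g : E → EReal} (hg : ∀ x, g x ≠ ⊥) : IsConvexFn (conj g) := by
  intro u hu v hv a b ha hb hab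
  simp only [Set.mem_ofPred_eq, conj_le_coe_iff hg, Prod.fst_add, Prod.snd_add, Prod.smul_fst,
    Prod.smul_snd, smul_eq_mul, inner_add_left, real_inner_smul_left] at hu hv ⊢
  intro x hx
  have h1 := mul_le_mul_of_nonneg_left (hu x hx) ha
  have h2 := mul_le_mul_of_nonneg_left (hv x hx) hb
  obtain rfl : b = 1 - a := by linarith
  linarith

lemma inner_sub_toReal_le_conj {g : E → EReal} (hg : ∀ x, g x ≠ ⊥) {x y : E}
    (hx : x ∈ effDom g) (hy : y ∈ effDom (conj g)) :
    inner ℝ y x - (g x).toReal ≤ (conj g y).toReal :=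
  (conj_le_coe_iff hg).1 (coe_toReal_of_mem_effDom (conj_ne_bot ⟨x, hx⟩) hy).ge x hx

lemma half_mul_norm_sub_add_smul_sq {c : ℝ} (hc : 0 < c) (w a v : E) :
    c / 2 * ‖w - (a + (1 / c) • v)‖ ^ 2 =
      c / 2 * ‖w - a‖ ^ 2 - inner ℝ v w + (inner ℝ v a + ‖v‖ ^ 2 / (2 * c)) := by
  rw [← sub_sub, norm_sub_sq_real, norm_smul, inner_smul_right, mul_pow, Real.norm_eq_abs, sq_abs,
    real_inner_comm, inner_sub_right]
  field_simp
  ring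

/-- The three-point inequality at the proximal point of a center shifted by a linear term. -/
lemma ASGARD.IsProx.three_point {h : E → EReal} (hh : ∀ x, h x ≠ ⊥) {L μ : ℝ} (hL : 0 < L)
    (hs : StrongConvexOn (effDom h) μ fun x => (h x).toReal) {a v z : E}
    (hz : IsProx (1 / L) h (a + (1 / L) • v) z) {w : E} (hw : w ∈ effDom h) :
    (h z).toReal - inner ℝ v z + L / 2 * ‖z - a‖ ^ 2 + (L + μ) / 2 * ‖w - z‖ ^ 2 ≤
      (h w).toReal - inner ℝ v w + L / 2 * ‖w - a‖ ^ 2 := by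
  have := hs.prox_three_point hz.1 hw fun w hw => hz.toReal_le hh hw
  rw [half_mul_norm_sub_add_smul_sq hL, half_mul_norm_sub_add_smul_sq hL] at this
  linarith

/-- The conjugate of a strongly convex function which has a proximal point is finite. -/
lemma effDom_conj_eq_univ {f : E → EReal} (hf : ∀ x, f x ≠ ⊥) {L μ : ℝ} (hμ : 0 < μ)
    (hs : StrongConvexOn (effDom f) μ fun x => (f x).toReal) {c z : E}
    (hz : IsProx (1 / L) f c z) : effDom (conj f) = Set.univ := by
  refine Set.eq_univ_of_forall fun v => ?_
  -- The proximal point supplies the subgradient `-L (z - c)` of `f` at `z`. The last term of the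
  -- bound is the maximum over `w` of `⟨v + L (z - c), w - z⟩ - μ/2 ‖w - z‖²`.
  refine lt_of_le_of_lt ((conj_le_coe_iff (c := inner ℝ v z - (f z).toReal +
    ‖v + L • (z - c)‖ ^ 2 / (2 * μ)) hf).2 fun w hw => ?_) (EReal.coe_lt_top _)
  have h := hs.prox_three_point hz.1 hw fun w hw => hz.toReal_le hf hw
  have h1 : ‖w - c‖ ^ 2 = ‖w - z‖ ^ 2 + 2 * inner ℝ (w - z) (z - c) + ‖z - c‖ ^ 2 := by
    rw [← norm_add_sq_real, sub_add_sub_cancel]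
  have h2 : 0 ≤ ‖(v + L • (z - c)) - μ • (w - z)‖ ^ 2 / (2 * μ) := by positivity
  have h3 : ‖(v + L • (z - c)) - μ • (w - z)‖ ^ 2 / (2 * μ) =
      ‖v + L • (z - c)‖ ^ 2 / (2 * μ) - inner ℝ (v + L • (z - c)) (w - z) +
        μ / 2 * ‖w - z‖ ^ 2 := by
    rw [norm_sub_sq_real, norm_smul, inner_smul_right, mul_pow, Real.norm_eq_abs, sq_abs]
    field_simp
  have h4 : inner ℝ (v + L • (z - c)) (w - z) =
      inner ℝ v w - inner ℝ v z + L * inner ℝ (w - z) (z - c) := by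
    rw [inner_add_left, real_inner_smul_left, inner_sub_right, real_inner_comm (w - z)]
  rw [h1] at h
  linarith

/-- Along the ray `t x`, Fenchel-Young gives `f*(t x) ≥ t ‖x‖² - f(x)`, while the Lipschitz bound
gives `f*(t x) ≤ f*(0) + t M ‖x‖`. Letting `t` grow excludes `‖x‖ > M`. -/
lemma norm_le_of_isLipschitzOnDom_conj {f : E → EReal} (hf : ∀ x, f x ≠ ⊥)
    (hdom : effDom (conj f) = Set.univ) {M : ℝ} (hM : IsLipschitzOnDom M (conj f)) {x : E}
    (hx : x ∈ effDom f) : ‖x‖ ≤ M := by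
  by_contra! hlt
  have hM0 := hM.1
  have hmem : ∀ v, v ∈ effDom (conj f) := fun v => hdom ▸ Set.mem_univ v
  set r := (conj f 0).toReal + (f x).toReal with hr
  have key : ∀ t : ℝ, 0 ≤ t → t * (‖x‖ * (‖x‖ - M)) ≤ r := by
    intro t ht
    have h1 := inner_sub_toReal_le_conj hf hx (hmem (t • x))
    have h2 := (le_abs_self _).trans (hM.2 _ (hmem (t • x)) _ (hmem 0))
    rw [sub_zero, norm_smul, Real.norm_of_nonneg ht] at h2
    rw [real_inner_smul_left, real_inner_self_eq_norm_sq] at h1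
    nlinarith
  have hδ : 0 < ‖x‖ * (‖x‖ - M) := mul_pos (by linarith) (by linarith)
  have h := key ((|r| + 1) / (‖x‖ * (‖x‖ - M))) (by positivity)
  rw [div_mul_cancel₀ _ hδ.ne'] at h
  linarith [le_abs_self r]

/-- A convex function which is `M`-Lipschitz on its domain has a subgradient of norm at most `M`
at each point of its domain. -/
lemma exists_subgradient_norm_le [CompleteSpace E] {g : E → EReal} (hg : ∀ x, g x ≠ ⊥)
    (hc : IsConvexFn g) {M : ℝ} (hM : IsLipschitzOnDom M g) {u : E} (hu : u ∈ effDom g) :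
    ∃ v ∈ effDom (conj g), ‖v‖ ≤ M ∧ (g u).toReal ≤ inner ℝ v u - (conj g v).toReal := by
  set G : E → ℝ := fun x => (g x).toReal with hG
  have hGc := hc.convexOn_toReal hg
  have hcone : ConvexOn ℝ Set.univ fun q : E => M * ‖q - u‖ := by
    have h := (convexOn_univ_norm (E := E)).translate_left (-u)
    simp only [Set.preimage_univ] at h
    simpa [Function.comp_def, sub_eq_add_neg, add_comm] using h.smul hM.1
  -- The open region below the cone `g(u) - M ‖· - u‖` misses the epigraph by the Lipschitz bound. A
  -- separating hyperplane passes through `(u, g(u))`; lying below the epigraph gives the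
  -- subgradient, lying above the cone bounds its slope by `M`.
  have hconv : Convex ℝ {q : E × ℝ | q.2 + M * ‖q.1 - u‖ < G u} := by
    intro a ha b hb s t hs ht hst
    simp only [Set.mem_ofPred_eq] at ha hb ⊢
    have h1 := hcone.2 (Set.mem_univ a.1) (Set.mem_univ b.1) hs ht hst
    simp only [smul_eq_mul, Prod.fst_add, Prod.snd_add, Prod.smul_fst, Prod.smul_snd] at h1 ⊢
    rcases hs.eq_or_lt with rfl | hs'
    · obtain rfl : t = 1 := by linarith
      linarith
    · have h2 := mul_lt_mul_of_pos_left ha hs'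
      have h3 := mul_le_mul_of_nonneg_left hb.le ht
      have h4 : s * G u + t * G u = G u := by rw [← add_mul, hst, one_mul]
      linarith
  have hopen : IsOpen {q : E × ℝ | q.2 + M * ‖q.1 - u‖ < G u} :=
    isOpen_lt (by fun_prop) continuous_const
  have hdisj : Disjoint {q : E × ℝ | q.2 + M * ‖q.1 - u‖ < G u}
      {q : E × ℝ | q.1 ∈ effDom g ∧ G q.1 ≤ q.2} := by
    rw [Set.disjoint_left]
    rintro ⟨a, r⟩ h1 ⟨h2, h3⟩
    have h4 := (le_abs_self _).trans (hM.2 u hu a h2)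
    rw [norm_sub_rev] at h4
    simp only [Set.mem_ofPred_eq, hG] at h1 h3
    linarith
  obtain ⟨Φ, s, hΦ1, hΦ2⟩ := geometric_hahn_banach_open hconv hopen hGc.convex_epigraph hdisj
  set ℓ : StrongDual ℝ E := Φ.comp (ContinuousLinearMap.inl ℝ E ℝ) with hℓ
  set c : ℝ := Φ (0, 1) with hcdef
  have hΦ : ∀ (a : E) (r : ℝ), Φ (a, r) = ℓ a + r * c := by
    intro a r
    have : ((a, r) : E × ℝ) = (a, 0) + r • (0, 1) := by simp
    rw [this, map_add, map_smul]
    rfl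
  have hepi : ∀ a ∈ effDom g, s ≤ ℓ a + G a * c := fun a ha => hΦ a _ ▸ hΦ2 (a, G a) ⟨ha, le_rfl⟩
  have hlow : ∀ (a : E) (r : ℝ), r + M * ‖a - u‖ < G u → ℓ a + r * c < s :=
    fun a r h => hΦ a r ▸ hΦ1 (a, r) h
  have hcpos : 0 < c := by
    have h1 := hepi u hu
    have h2 := hlow u (G u - 1) (by simp)
    linarith
  have hle : ∀ a : E, ℓ a + (G u - M * ‖a - u‖) * c ≤ s := by
    intro a
    refine le_of_forall_pos_lt_add fun ε hε => ?_
    have h := hlow a (G u - M * ‖a - u‖ - ε / c) (by have : 0 < ε / c := by positivity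
                                                     linarith)
    rw [sub_mul, div_mul_cancel₀ _ hcpos.ne'] at h
    linarith
  have hs : s = ℓ u + G u * c := le_antisymm (hepi u hu) (by simpa using hle u)
  set v : E := -((1 / c) • (InnerProductSpace.toDual ℝ E).symm ℓ) with hv
  have hvin : ∀ a, inner ℝ v a = -(ℓ a / c) := by
    intro a
    rw [hv, inner_neg_left, real_inner_smul_left, InnerProductSpace.toDual_symm_apply]
    ring
  have hconj : conj g v ≤ ((inner ℝ v u - G u : ℝ) : EReal) := by
    rw [conj_le_coe_iff hg]
    intro a ha
    have h := hepi a ha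
    rw [hs] at h
    have h2 : (ℓ u + G u * c) / c ≤ (ℓ a + G a * c) / c := by gcongr
    rw [add_div, add_div, mul_div_cancel_right₀ _ hcpos.ne', mul_div_cancel_right₀ _ hcpos.ne'] at h2
    rw [hvin, hvin]
    linarith
  have hvmem : v ∈ effDom (conj g) := hconj.trans_lt (EReal.coe_lt_top _)
  refine ⟨v, hvmem, ?_, ?_⟩
  -- Moving from `u` in the direction `-v` makes the hyperplane fall at its full slope `‖v‖`.
  · have h := hle (u - v)
    rw [hs, map_sub] at h
    have h2 : ℓ v = -(‖v‖ ^ 2 * c) := by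
      have := hvin v
      rw [real_inner_self_eq_norm_sq] at this
      rw [this]; field_simp
    simp only [sub_sub_cancel_left, norm_neg, h2] at h
    have h3 : ‖v‖ * (‖v‖ * c) ≤ M * (‖v‖ * c) := by linarith
    rcases (norm_nonneg v).eq_or_lt with h0 | h0
    · rw [← h0]; exact hM.1
    · exact le_of_mul_le_mul_right h3 (mul_pos h0 hcpos)
  · rw [← coe_toReal_of_mem_effDom (conj_ne_bot ⟨u, hu⟩) hvmem] at hconj
    have := EReal.coe_le_coe_iff.1 hconj
    simp only [hG] at this
    linarith

end ExtendedReal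

/-! ### Weak duality and the pointwise gap bound. -/

section Rates

variable {p n : ℕ} {f : EuclideanSpace ℝ (Fin p) → EReal} {g : EuclideanSpace ℝ (Fin n) → EReal}
  {K : EuclideanSpace ℝ (Fin p) →L[ℝ] EuclideanSpace ℝ (Fin n)}

/-- The Lagrangian with the values of `f` and `g*` read as real numbers. -/
noncomputable def lagrReal (f : EuclideanSpace ℝ (Fin p) → EReal)
    (g : EuclideanSpace ℝ (Fin n) → EReal)
    (K : EuclideanSpace ℝ (Fin p) →L[ℝ] EuclideanSpace ℝ (Fin n))
    (x : EuclideanSpace ℝ (Fin p)) (y : EuclideanSpace ℝ (Fin n)) : ℝ :=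
  (f x).toReal + inner ℝ (K x) y - (conj g y).toReal

lemma lagr_eq_coe (hf : ∀ x, f x ≠ ⊥) (hg : (effDom g).Nonempty) {x : EuclideanSpace ℝ (Fin p)}
    {y : EuclideanSpace ℝ (Fin n)} (hx : x ∈ effDom f) (hy : y ∈ effDom (conj g)) :
    lagr f g K x y = lagrReal f g K x y := by
  rw [lagr, lagrReal, EReal.coe_sub, EReal.coe_add, coe_toReal_of_mem_effDom hf hx,
    coe_toReal_of_mem_effDom (conj_ne_bot hg) hy]

lemma ASGARD.IsSaddle.lagrReal_le (hf : ∀ x, f x ≠ ⊥) (hg : (effDom g).Nonempty)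
    {xs : EuclideanSpace ℝ (Fin p)} {ys : EuclideanSpace ℝ (Fin n)} (h : IsSaddle f g K xs ys)
    {y : EuclideanSpace ℝ (Fin n)} (hy : y ∈ effDom (conj g)) :
    lagrReal f g K xs y ≤ lagrReal f g K xs ys := by
  have := (h.2.2 xs h.1 y hy).1
  rwa [lagr_eq_coe hf hg h.1 hy, lagr_eq_coe hf hg h.1 h.2.1, EReal.coe_le_coe_iff] at this

lemma ASGARD.IsSaddle.le_lagrReal (hf : ∀ x, f x ≠ ⊥) (hg : (effDom g).Nonempty)
    {xs : EuclideanSpace ℝ (Fin p)} {ys : EuclideanSpace ℝ (Fin n)} (h : IsSaddle f g K xs ys)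
    {x : EuclideanSpace ℝ (Fin p)} (hx : x ∈ effDom f) :
    lagrReal f g K xs ys ≤ lagrReal f g K x ys := by
  have := (h.2.2 x hx ys h.2.1).2
  rwa [lagr_eq_coe hf hg hx h.2.1, lagr_eq_coe hf hg h.1 h.2.1, EReal.coe_le_coe_iff] at this

/-- Fenchel-Young gives `L(x, y*) ≤ F(x)`. Only this inequality between the saddle value and the
optimum is needed for an upper bound on the primal residual. -/
lemma ASGARD.IsSaddle.lagrReal_le_primalVal (hf : ∀ x, f x ≠ ⊥) (hg : ∀ x, g x ≠ ⊥)
    (hgd : (effDom g).Nonempty) {xs : EuclideanSpace ℝ (Fin p)} {ys : EuclideanSpace ℝ (Fin n)}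
    (h : IsSaddle f g K xs ys) : (lagrReal f g K xs ys : EReal) ≤ primalVal f g K := by
  refine le_iInf fun x => ?_
  by_cases hx : x ∈ effDom f
  · by_cases hKx : K x ∈ effDom g
    · rw [primalObj, ← coe_toReal_of_mem_effDom hf hx, ← coe_toReal_of_mem_effDom hg hKx,
        ← EReal.coe_add, EReal.coe_le_coe_iff]
      have h1 := h.le_lagrReal hf hgd hx
      have h2 := inner_sub_toReal_le_conj hg hKx h.2.1
      rw [real_inner_comm] at h2
      rw [lagrReal.eq_1 f g K x ys] at h1
      linarith
    · rw [primalObj, eq_top_of_notMem_effDom hKx, EReal.add_top_of_ne_bot (hf x)]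
      exact le_top
  · rw [primalObj, eq_top_of_notMem_effDom hx, EReal.top_add_of_ne_bot (hg _)]
    exact le_top

lemma ASGARD.IsSaddle.neg_lagrReal_le_dualVal (hf : ∀ x, f x ≠ ⊥) (hgd : (effDom g).Nonempty)
    {xs : EuclideanSpace ℝ (Fin p)} {ys : EuclideanSpace ℝ (Fin n)}
    (h : IsSaddle f g K xs ys) : ((-lagrReal f g K xs ys : ℝ) : EReal) ≤ dualVal f g K := by
  refine le_iInf fun y => ?_
  by_cases hy : y ∈ effDom (conj g)
  · have h1 := h.lagrReal_le hf hgd hy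
    have h2 : ((inner ℝ (-(ContinuousLinearMap.adjoint K y)) xs - (f xs).toReal : ℝ) : EReal) ≤
        conj f (-(ContinuousLinearMap.adjoint K y)) := by
      rw [EReal.coe_sub, coe_toReal_of_mem_effDom hf h.1]
      exact le_iSup (fun x => ((inner ℝ (-(ContinuousLinearMap.adjoint K y)) x : ℝ) : EReal) - f x) xs
    rw [dualObj, ← coe_toReal_of_mem_effDom (conj_ne_bot hgd) hy]
    refine le_trans ?_ (add_le_add_left h2 _)
    rw [← EReal.coe_add, EReal.coe_le_coe_iff, inner_neg_left,
      ContinuousLinearMap.adjoint_inner_left, real_inner_comm]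
    rw [lagrReal.eq_1 f g K xs y] at h1
    linarith
  · rw [dualObj, eq_top_of_notMem_effDom hy, EReal.add_top_of_ne_bot (conj_ne_bot ⟨xs, h.1⟩ _)]
    exact le_top

variable {μf β₀ : ℝ} {yc : EuclideanSpace ℝ (Fin n)} {x xh : ℕ → EuclideanSpace ℝ (Fin p)}
  {y yt : ℕ → EuclideanSpace ℝ (Fin n)} {τ : ℕ → ℝ} {μg : ℝ}

lemma ASGARD.IsASGARDPlus.x_mem (h : IsASGARDPlus f g K μf μg β₀ yc τ x xh y yt) (k : ℕ) :
    x k ∈ effDom f := by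
  cases k with
  | zero => exact h.x_zero
  | succ k => exact (h.x_succ k).1

lemma ASGARD.IsASGARDPlus.yt_mem (hg : ∀ x, g x ≠ ⊥) (hgd : (effDom g).Nonempty)
    (h : IsASGARDPlus f g K μf μg β₀ yc tauSeq x xh y yt) (k : ℕ) : yt k ∈ effDom (conj g) := by
  induction k with
  | zero => exact h.yt_zero
  | succ k ih =>
    rw [h.yt_succ]
    exact ((isConvexFn_conj hg).convexOn_toReal (conj_ne_bot hgd)).1 ih (h.y_succ k).1
      (sub_nonneg.2 (tauSeq_le_one k)) (tauSeq_pos k).le (by ring)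

/-- All three rates are read off from this bound, which holds for arbitrary test points of the
domains. The iterate `x k` is controlled by `τ_{k-1}` and `β_{k-1}`, so `(k - 1) + 2` and `(k - 1) +
4` become the denominators `k + 1` and `k + 3`. -/
theorem ASGARD.IsASGARDPlus.lagrReal_sub_le (hK : K ≠ 0) (hf : ∀ x, f x ≠ ⊥) (hg : ∀ x, g x ≠ ⊥)
    (hgd : (effDom g).Nonempty) (hμ : 0 < μf)
    (hfs : StrongConvexOn (effDom f) μf fun x => (f x).toReal) (hβ : 0 < β₀)
    (hβ₀ : 0.382 * ‖K‖ ^ 2 / μf ≤ β₀) (h : IsASGARDPlus f g K μf 0 β₀ yc tauSeq x xh y yt)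
    {k : ℕ} (hk : 1 ≤ k) {w : EuclideanSpace ℝ (Fin p)} {v : EuclideanSpace ℝ (Fin n)}
    (hw : w ∈ effDom f) (hv : v ∈ effDom (conj g)) :
    lagrReal f g K (x k) v - lagrReal f g K w (yt k) ≤
      2 * ‖K‖ ^ 2 / (β₀ * ((k : ℝ) + 1) ^ 2) * ‖x 0 - w‖ ^ 2 +
        10 * β₀ / ((k : ℝ) + 3) ^ 2 * ‖yc - v‖ ^ 2 := by
  obtain ⟨k, rfl⟩ := Nat.exists_eq_add_of_le' hk
  have hKpos : 0 < ‖K‖ := norm_pos_iff.2 hK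
  have hβp := betaSeq_pos hβ
  have hLs : ∀ k, lipSeq K 0 (betaSeq β₀ tauSeq) k = ‖K‖ ^ 2 / betaSeq β₀ tauSeq k := fun k => by
    rw [lipSeq, zero_add]
  have hLp : ∀ k, 0 < lipSeq K 0 (betaSeq β₀ tauSeq) k := fun k => by
    have := hβp k
    rw [hLs]; positivity
  have hγ := (isConvexFn_conj hg).convexOn_toReal (conj_ne_bot hgd)
  have hγ0 : StrongConvexOn (effDom (conj g)) 0 fun y => (conj g y).toReal :=
    strongConvexOn_zero.2 hγ
  have hmain := smoothed_gap_estimate K hμ hβ hβ₀ hfs hγ (yc := yc) (xh := xh) (y := y) rfl hLs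
    (fun k => (h.y_succ k).1) (h.yt_mem hg hgd) h.x_mem
    (fun k v hv => by
      have := (h.y_succ k).three_point (conj_ne_bot hgd) (hβp k) hγ0 hv
      rw [add_zero] at this
      linarith)
    (fun k w hw => by
      have hx := h.x_succ k
      rw [sub_eq_add_neg, ← smul_neg] at hx
      have := hx.three_point hf (hLp k) hfs hw
      simp only [inner_neg_left, ContinuousLinearMap.adjoint_inner_left] at this
      rw [real_inner_comm, real_inner_comm (K w)] at this
      linarith)
    h.xh_zero h.xh_succ h.yt_succ k w hw v hv
  have hb := betaSeq_le hβ k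
  have ht := tauSeq_le k
  have ht0 := (tauSeq_pos k).le
  have hL0 : lipSeq K 0 (betaSeq β₀ tauSeq) 0 = ‖K‖ ^ 2 / β₀ := hLs 0
  have e1 : tauSeq k ^ 2 * (lipSeq K 0 (betaSeq β₀ tauSeq) 0 / 2 * ‖x 0 - w‖ ^ 2) ≤
      2 * ‖K‖ ^ 2 / (β₀ * (((k + 1 : ℕ) : ℝ) + 1) ^ 2) * ‖x 0 - w‖ ^ 2 := by
    rw [hL0]
    calc _ ≤ (2 / ((k : ℝ) + 2)) ^ 2 * (‖K‖ ^ 2 / β₀ / 2 * ‖x 0 - w‖ ^ 2) := by gcongr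
      _ = _ := by
        push_cast
        have : (k : ℝ) + 1 + 1 = k + 2 := by ring
        rw [this]
        field_simp
  have e2 : betaSeq β₀ tauSeq k / 2 * ‖v - yc‖ ^ 2 ≤
      10 * β₀ / (((k + 1 : ℕ) : ℝ) + 3) ^ 2 * ‖yc - v‖ ^ 2 := by
    rw [norm_sub_rev]
    refine mul_le_mul_of_nonneg_right ?_ (by positivity)
    push_cast
    have : (k : ℝ) + 1 + 3 = k + 4 := by ring
    rw [this]
    have : 10 * β₀ / ((k : ℝ) + 4) ^ 2 = 20 * β₀ / (k + 4) ^ 2 / 2 := by ring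
    linarith
  have e3 : 0 ≤ (lipSeq K 0 (betaSeq β₀ tauSeq) k + μf) / 2 *
      ‖(1 - tauSeq k) • x k + tauSeq k • w - x (k + 1)‖ ^ 2 := by
    have := hLp k
    positivity
  unfold lagrReal
  linarith

end Rates

/-! ### The three convergence rates. -/

theorem theorem2 {p n : ℕ}
    (f : EuclideanSpace ℝ (Fin p) → EReal) (g : EuclideanSpace ℝ (Fin n) → EReal)
    (K : EuclideanSpace ℝ (Fin p) →L[ℝ] EuclideanSpace ℝ (Fin n)) (hK : K ≠ 0)
    (hf : IsProperClosedConvex f) (hg : IsProperClosedConvex g)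
    (hsaddle : ∃ xs ys, IsSaddle f g K xs ys)
    (hslater : Slater f g K)
    (μf : ℝ) (hμf : 0 < μf) (hfs : IsStronglyConvexFn μf f)
    (β₀ : ℝ) (hβ₀ : 0.382 * ‖K‖ ^ 2 / μf ≤ β₀)
    (yc : EuclideanSpace ℝ (Fin n))
    (x xh : ℕ → EuclideanSpace ℝ (Fin p)) (y yt : ℕ → EuclideanSpace ℝ (Fin n))
    (halg : IsASGARDPlus f g K μf 0 β₀ yc tauSeq x xh y yt)
    (k : ℕ) (hk : 1 ≤ k) :
    (∀ (X : Set (EuclideanSpace ℝ (Fin p))) (Y : Set (EuclideanSpace ℝ (Fin n))),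
      X ⊆ effDom f → Y ⊆ effDom (conj g) →
      X.Nonempty → IsClosed X → Convex ℝ X →
      Y.Nonempty → IsClosed Y → Convex ℝ Y →
      (∃ xs ∈ X, ∃ ys ∈ Y, IsSaddle f g K xs ys) →
      gap f g K X Y (x k) (yt k) ≤
        ((2 * ‖K‖ ^ 2 / (β₀ * ((k : ℝ) + 1) ^ 2) : ℝ) : EReal) *
            (⨆ x' ∈ X, ((‖x 0 - x'‖ ^ 2 : ℝ) : EReal)) +
          ((10 * β₀ / ((k : ℝ) + 3) ^ 2 : ℝ) : EReal) *
            (⨆ y' ∈ Y, ((‖yc - y'‖ ^ 2 : ℝ) : EReal))) ∧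
    (∀ Mg : ℝ, IsLipschitzOnDom Mg g → K (x k) ∈ effDom g →
      ∀ xs ys, IsSaddle f g K xs ys →
        primalObj f g K (x k) - primalVal f g K ≤
          ((2 * ‖K‖ ^ 2 * ‖x 0 - xs‖ ^ 2 / (β₀ * ((k : ℝ) + 1) ^ 2) +
            10 * β₀ * (‖yc‖ + Mg) ^ 2 / ((k : ℝ) + 3) ^ 2 : ℝ) : EReal)) ∧
    (∀ Mf : ℝ, IsLipschitzOnDom Mf (conj f) →
      ∀ xs ys, IsSaddle f g K xs ys →
        dualObj f g K (yt k) - dualVal f g K ≤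
          ((2 * ‖K‖ ^ 2 * (‖x 0‖ + Mf) ^ 2 / (β₀ * ((k : ℝ) + 1) ^ 2) +
            10 * β₀ * ‖yc - ys‖ ^ 2 / ((k : ℝ) + 3) ^ 2 : ℝ) : EReal)) := by
  have hKpos : 0 < ‖K‖ := norm_pos_iff.2 hK
  have hβ : 0 < β₀ := lt_of_lt_of_le (by positivity) hβ₀
  have hfb := hf.ne_bot
  have hgb := hg.ne_bot
  have hgd := hg.nonempty_dom
  have hφ := hfs.strongConvexOn_toReal hfb
  have hxk := halg.x_mem k
  have hytk := halg.yt_mem hgb hgd k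
  have key := fun w hw v hv =>
    halg.lagrReal_sub_le hK hfb hgb hgd hμf hφ hβ hβ₀ hk (w := w) (v := v) hw hv
  have hA : 0 ≤ 2 * ‖K‖ ^ 2 / (β₀ * ((k : ℝ) + 1) ^ 2) := by positivity
  have hB : 0 ≤ 10 * β₀ / ((k : ℝ) + 3) ^ 2 := by positivity
  refine ⟨fun X Y hX hY _ _ _ _ _ _ _ => ?_, fun M hM hKx xs ys hs => ?_,
    fun M hM xs ys hs => ?_⟩
  · refine iSup₂_le fun w hw => iSup₂_le fun v hv => ?_
    rw [lagr_eq_coe hfb hgd hxk (hY hv), lagr_eq_coe hfb hgd (hX hw) hytk, ← EReal.coe_sub]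
    refine (EReal.coe_le_coe_iff.2 (key w (hX hw) v (hY hv))).trans ?_
    rw [EReal.coe_add, EReal.coe_mul, EReal.coe_mul]
    refine add_le_add (mul_le_mul_of_nonneg_left ?_ (EReal.coe_nonneg.2 hA))
      (mul_le_mul_of_nonneg_left ?_ (EReal.coe_nonneg.2 hB))
    · exact le_iSup₂ (f := fun (x' : EuclideanSpace ℝ (Fin p)) (_ : x' ∈ X) =>
        ((‖x 0 - x'‖ ^ 2 : ℝ) : EReal)) w hw
    · exact le_iSup₂ (f := fun (y' : EuclideanSpace ℝ (Fin n)) (_ : y' ∈ Y) =>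
        ((‖yc - y'‖ ^ 2 : ℝ) : EReal)) v hv
  -- A subgradient `v` at `K x^k` turns `L(x^k, v)` into an upper bound for `F(x^k)`.
  · obtain ⟨v, hv, hvM, hle⟩ := exists_subgradient_norm_le hgb hg.convex hM hKx
    have h1 := key xs hs.1 v hv
    have h2 := hs.lagrReal_le hfb hgd hytk
    refine (EReal.sub_le_sub le_rfl (hs.lagrReal_le_primalVal hfb hgb hgd)).trans ?_
    rw [primalObj, ← coe_toReal_of_mem_effDom hfb hxk, ← coe_toReal_of_mem_effDom hgb hKx,
      ← EReal.coe_add, ← EReal.coe_sub, EReal.coe_le_coe_iff]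
    have h3 : ‖yc - v‖ ^ 2 ≤ (‖yc‖ + M) ^ 2 :=
      pow_le_pow_left₀ (norm_nonneg _) ((norm_sub_le _ _).trans (by linarith)) 2
    have h4 := mul_le_mul_of_nonneg_left h3 hB
    rw [lagrReal.eq_1 f g K (x k) v, real_inner_comm] at h1
    rw [div_mul_eq_mul_div, div_mul_eq_mul_div] at h1
    rw [div_mul_eq_mul_div, div_mul_eq_mul_div] at h4
    linarith
  · refine (EReal.sub_le_sub le_rfl (hs.neg_lagrReal_le_dualVal hfb hgd)).trans ?_
    -- The conjugate is the supremum of `-⟨K w, ỹ^k⟩ - f(w)`, so the gap bound is taken at `v = y*`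
    -- for every `w`, uniformly because `dom f` lies in the ball of radius `M`.
    have hbound : conj f (-(ContinuousLinearMap.adjoint K (yt k))) ≤
        ((2 * ‖K‖ ^ 2 * (‖x 0‖ + M) ^ 2 / (β₀ * ((k : ℝ) + 1) ^ 2) +
            10 * β₀ * ‖yc - ys‖ ^ 2 / ((k : ℝ) + 3) ^ 2 - lagrReal f g K xs ys -
            (conj g (yt k)).toReal : ℝ) : EReal) := by
      rw [conj_le_coe_iff hfb]
      intro w hw
      have h1 := key w hw ys hs.2.1
      have h2 := hs.le_lagrReal hfb hgd hxk
      have hwM := norm_le_of_isLipschitzOnDom_conj hfb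
        (effDom_conj_eq_univ hfb hμf hφ (halg.x_succ 0)) hM hw
      have h3 : ‖x 0 - w‖ ^ 2 ≤ (‖x 0‖ + M) ^ 2 :=
        pow_le_pow_left₀ (norm_nonneg _) ((norm_sub_le _ _).trans (by linarith)) 2
      have h4 := mul_le_mul_of_nonneg_left h3 hA
      rw [lagrReal.eq_1 f g K w (yt k)] at h1
      rw [div_mul_eq_mul_div, div_mul_eq_mul_div] at h1
      rw [div_mul_eq_mul_div, div_mul_eq_mul_div] at h4
      rw [inner_neg_left, ContinuousLinearMap.adjoint_inner_left, real_inner_comm]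
      linarith
    rw [dualObj, ← coe_toReal_of_mem_effDom (conj_ne_bot hgd) hytk]
    refine (EReal.sub_le_sub (add_le_add_left hbound _) le_rfl).trans ?_
    rw [← EReal.coe_add, ← EReal.coe_sub, EReal.coe_le_coe_iff]
    linarith
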